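/- One indivisible object may be sold to one of two bidders. Bidder $i$'s value $v_i$ lies in $[0,\bar v_i]$, where $\bar v_1\ge\bar v_2>0$. A mechanism consists of measurable allocation functions $x_i:[0,\bar v_1]\times[0,\bar v_2]\to\{0,1\}$ with $x_1+x_2\le 1$ and measurable transfers $t_i:[0,\bar v_1]\times[0,\bar v_2]\to\mathbb R$. Let $\mathcal M$ be the set of mechanisms that are dominant-strategy incentive compatible and ex post individually rational. For $m\in[0,\bar v_1]\times[0,\bar v_2]$ let $\Delta(m)$ be the set of Borel probability measures $F$ on $[0,\bar v_1]\times[0,\bar v_2]$ with $\int v_i\,dF=m_i$, $i=1,2$. A mechanism is called optimal (for $m$) if it lies in $\mathcal M$ and attains $$\sup_{M\in\mathcal M}\ \inf_{F\in\Delta(m)}\int (t_1+t_2)\,dF .$$ For $\alpha_i\ge 0$, $\beta_i>0$ let $s_i(v_i)=\beta_iv_i-\alpha_i$. A linear score auction with parameters $(\alpha,\beta)$ is a mechanism in $\mathcal M$ with $x_i(v)=1$ if $s_i(v_i)>\max\{s_j(v_j),0\}$ and $x_i(v)=0$ if $s_i(v_i)<\max\{s_j(v_j),0\}$, where $j\neq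 i$. It is corner-hitting if, for some $r_i\in[0,\bar v_i]$, one can take $s_i(v_i)=(v_i-r_i)/(\bar v_i-r_i)$ when $r_i<\bar v_i$ and $s_i(v_i)=v_i-r_i$ when $r_i=\bar v_i$. Theorem. (a) For every $m\in[0,\bar v_1]\times[0,\bar v_2]$ there are $r_1\in[0,\bar v_1]$, $r_2\in[0,\bar v_2]$ and $\gamma>0$, and an optimal mechanism that is a linear score auction with scores $s_1(v_1)=\gamma(v_1-r_1)$ and $s_2(v_2)=v_2-r_2$. (b) Such an auction is in general not corner-hitting: if $\bar v_1>\bar v_2$, there is $\varepsilon>0$ such that for all means with $\bar v_i-\varepsilon<m_i<\bar v_i$, $i=1,2$, no optimal mechanism is a corner-hitting linear score auction. -/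

import Mathlib

open MeasureTheory
open scoped ENNReal

noncomputable section

namespace RobustAuction

/-- Value profiles: bidder `i`'s value lies in `[0, vbar i]`. -/
abbrev Profile {n : ℕ} (vbar : Fin n → ℝ) : Type :=
  (i : Fin n) → Set.Icc (0 : ℝ) (vbar i)

/-- A direct deterministic mechanism for one indivisible object: measurable allocation functions
with values in `{0, 1}` that allocate the object at most once, and measurable transfers
(paid by the bidders to the seller). -/
structure Mechanism {n : ℕ} (vbar : Fin n → ℝ) where
  alloc : Fin n → Profile vbar → ℝ
  pay : Fin n → Profile vbar → ℝ
  measurable_alloc : ∀ i, Measurable (alloc i)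
  measurable_pay : ∀ i, Measurable (pay i)
  alloc_eq : ∀ i v, alloc i v = 0 ∨ alloc i v = 1
  sum_alloc_le : ∀ v, ∑ i, alloc i v ≤ 1

namespace Mechanism

variable {n : ℕ} {vbar : Fin n → ℝ}

/-- Dominant-strategy incentive compatibility: whatever the others report, no bidder gains by
reporting `w` instead of her true value. -/
def IsDSIC (M : Mechanism vbar) : Prop :=
  ∀ (i : Fin n) (v : Profile vbar) (w : Set.Icc (0 : ℝ) (vbar i)),
    (v i : ℝ) * M.alloc i (Function.update v i w) - M.pay i (Function.update v i w)
      ≤ (v i : ℝ) * M.alloc i v - M.pay i v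

/-- Ex post individual rationality. -/
def IsEPIR (M : Mechanism vbar) : Prop :=
  ∀ (i : Fin n) (v : Profile vbar), 0 ≤ (v i : ℝ) * M.alloc i v - M.pay i v

/-- The feasible class: DSIC and ex post IR. -/
def IsFeasible (M : Mechanism vbar) : Prop := M.IsDSIC ∧ M.IsEPIR

/-- The seller's ex post revenue. -/
def revenue (M : Mechanism vbar) (v : Profile vbar) : ℝ := ∑ i, M.pay i v

/-- The seller's expected revenue under `F`, as an extended real: integral of the positive part
minus integral of the negative part. Under ex post IR the revenue is bounded above, so that the
first integral is finite and the difference is meaningful (possibly `-∞`). -/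
def expectedRevenue (M : Mechanism vbar) (F : Measure (Profile vbar)) : EReal :=
  ((∫⁻ v, ENNReal.ofReal (M.revenue v) ∂F : ℝ≥0∞) : EReal)
    - ((∫⁻ v, ENNReal.ofReal (-M.revenue v) ∂F : ℝ≥0∞) : EReal)

end Mechanism

variable {n : ℕ} {vbar : Fin n → ℝ}

/-- The Borel probability distributions on the box of value profiles with vector of means `m`. -/
def distributions (vbar m : Fin n → ℝ) : Set (Measure (Profile vbar)) :=
  {F | IsProbabilityMeasure F ∧ ∀ i, ∫ v, (v i : ℝ) ∂F = m i}

namespace Mechanism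

/-- The revenue guarantee: worst-case expected revenue over all distributions with means `m`. -/
def guarantee (M : Mechanism vbar) (m : Fin n → ℝ) : EReal :=
  ⨅ F ∈ distributions vbar m, M.expectedRevenue F

/-- `M` solves the seller's problem `sup_M inf_F R(M, F)` over feasible mechanisms. -/
def IsOptimal (M : Mechanism vbar) (m : Fin n → ℝ) : Prop :=
  M.IsFeasible ∧ ∀ M' : Mechanism vbar, M'.IsFeasible → M'.guarantee m ≤ M.guarantee m

end Mechanism

/-- Bidder `i`'s linear score `β i * v i - α i`. -/
def score (α β : Fin n → ℝ) (v : Profile vbar) (i : Fin n) : ℝ := β i * (v i : ℝ) - α i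

/-- The score bidder `i` has to beat: `max {max_{j ≠ i} s_j(v_j), 0}`. -/
def scoreToBeat (α β : Fin n → ℝ) (v : Profile vbar) (i : Fin n) : ℝ :=
  (Finset.univ.erase i).fold max 0 (score α β v)

namespace Mechanism

/-- `M` is a linear score auction with parameters `α i ≥ 0`, `β i > 0`. Ties are unrestricted,
beyond feasibility of the mechanism. -/
def IsLSAWith (M : Mechanism vbar) (α β : Fin n → ℝ) : Prop :=
  M.IsFeasible ∧ (∀ i, 0 ≤ α i) ∧ (∀ i, 0 < β i) ∧
    ∀ (i : Fin n) (v : Profile vbar),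
      (scoreToBeat α β v i < score α β v i → M.alloc i v = 1) ∧
      (score α β v i < scoreToBeat α β v i → M.alloc i v = 0)

/-- `M` is a corner-hitting linear score auction: for some generalized reserve prices
`r i ∈ [0, vbar i]`, bidder `i`'s score is `(v i - r i) / (vbar i - r i)` if `r i < vbar i`, and
`v i - r i` if `r i = vbar i`. -/
def IsCornerHittingLSA (M : Mechanism vbar) : Prop :=
  ∃ r : Fin n → ℝ, (∀ i, r i ∈ Set.Icc (0 : ℝ) (vbar i)) ∧
    M.IsLSAWith
      (fun i => if r i < vbar i then r i / (vbar i - r i) else r i)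
      (fun i => if r i < vbar i then 1 / (vbar i - r i) else 1)

end Mechanism

end RobustAuction

end

noncomputable section

namespace RobustAuction

/-! ### Incentive compatibility, threshold prices and revenue bounds -/

namespace Mechanism

variable {n : ℕ} {vbar : Fin n → ℝ}

/-! Duality turns the seller's problem into one about affine functions. The guarantee of a mechanism
at `m` is governed by the values at `m` of affine functions lying below its ex post revenue on the
face of the box that carries the distributions: integrating such a minorant bounds the guarantee
from below (`le_guarantee`), and separating a point from the convex set of pairs (means, upper
bounds on expected revenue) produces one (`exists_affine_minorant`).

Let `f` be affine and below the revenue of a feasible mechanism, and write `b0`, `b1` for the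
highest values. Where `f > 0` some bidder wins. Her price is at most her value and stays the same as
her value rises to the top, so `f (b0, y) ≤ x` or `f (x, b1) ≤ y`. This is `IsAttainable`, once
negative slopes are cut to zero, which can only raise `f m`. Conversely, an attainable `f` that is
positive somewhere admits a straight line of equal scores from a point `(r0, r1)` with `f ≤ 0` to a
point `(t, b1)`. Threshold prices are affine along this line, so comparing them with `f` at its two
ends suffices (`exists_reserves`, `exists_linearScore_ge`). By compactness some attainable `f` is
best at `m`, and the auction securing it is optimal. Means with `m 0 = b0` or `m 1 = b1` get
separate, simpler versions of the argument.

For (b), take means near `(b0, b1)`. A corner-hitting auction with `r 1 < b1` sells to bidder `1` at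
`(x, b1)` for every `x < b0`, so it secures little more than `b1`. With `r 1 = b1` it is in effect a
posted price for bidder `0`, worth at most `(√b0 - √(b0 - m 0))²`. A score line meeting the top edge
at `b0 - √(b0 (b0 - m 0))` beats both: if bidder `0` refuses, bidder `1` still buys. -/

theorem measurable_revenue (M : Mechanism vbar) : Measurable M.revenue :=
  Finset.measurable_sum _ fun i _ => M.measurable_pay i

theorem alloc_nonneg (M : Mechanism vbar) (i : Fin n) (v : Profile vbar) : 0 ≤ M.alloc i v := by
  rcases M.alloc_eq i v with h | h <;> simp [h]

theorem alloc_le_one (M : Mechanism vbar) (i : Fin n) (v : Profile vbar) : M.alloc i v ≤ 1 := by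
  rcases M.alloc_eq i v with h | h <;> simp [h]

theorem IsEPIR.pay_le {M : Mechanism vbar} (h : M.IsEPIR) (i : Fin n) (v : Profile vbar) :
    M.pay i v ≤ (v i : ℝ) * M.alloc i v := sub_nonneg.1 (h i v)

theorem IsEPIR.pay_le_value {M : Mechanism vbar} (h : M.IsEPIR) (i : Fin n) (v : Profile vbar) :
    M.pay i v ≤ (v i : ℝ) :=
  (h.pay_le i v).trans (mul_le_of_le_one_right (v i).2.1 (M.alloc_le_one i v))

theorem IsEPIR.revenue_le_sum {M : Mechanism vbar} (h : M.IsEPIR) (v : Profile vbar) :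
    M.revenue v ≤ ∑ i, vbar i :=
  Finset.sum_le_sum fun i _ => (h.pay_le_value i v).trans (v i).2.2

/-- Raising the value of a winner changes neither her allocation nor her payment. -/
theorem IsDSIC.winner_update {M : Mechanism vbar} (h : M.IsDSIC) {i : Fin n} {v : Profile vbar}
    {w : Set.Icc (0 : ℝ) (vbar i)} (hx : M.alloc i v = 1) (hw : (v i : ℝ) ≤ w) :
    M.alloc i (Function.update v i w) = 1 ∧ M.pay i (Function.update v i w) = M.pay i v := by
  -- Adding the two incentive constraints between `v i` and `w` gives monotonicity of the
  -- allocation; with equal allocations they force equal payments.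
  have h1 := h i v w
  have h2 := h i (Function.update v i w) (v i)
  simp only [Function.update_idem, Function.update_eq_self, Function.update_self, hx] at h1 h2
  rcases hw.eq_or_lt with heq | hlt
  · have : Function.update v i w = v := by
      rw [← Subtype.ext heq, Function.update_eq_self]
    rw [this]; exact ⟨hx, rfl⟩
  · rcases M.alloc_eq i (Function.update v i w) with h0 | h0
    · rw [h0] at h1 h2; linarith
    · rw [h0] at h1 h2; exact ⟨h0, by linarith⟩

/-- A mechanism in which every bidder faces a threshold price that does not depend on her own
report is feasible. -/
theorem isFeasible_of_threshold {M : Mechanism vbar} (p : Fin n → Profile vbar → ℝ)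
    (hp : ∀ i v w, p i (Function.update v i w) = p i v)
    (hpay : ∀ i v, M.pay i v = p i v * M.alloc i v)
    (hwin : ∀ i v, M.alloc i v = 1 → p i v ≤ v i)
    (hlose : ∀ i v, M.alloc i v = 0 → (v i : ℝ) ≤ p i v) : M.IsFeasible := by
  refine ⟨fun i v w => ?_, fun i v => ?_⟩
  · rw [hpay, hpay, hp]
    rcases M.alloc_eq i v with h | h <;>
      rcases M.alloc_eq i (Function.update v i w) with h' | h' <;> rw [h, h']
    · linarith [hlose i v h]
    · linarith [hwin i v h]
  · rw [hpay]
    rcases M.alloc_eq i v with h | h <;> rw [h]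
    · simp
    · linarith [hwin i v h]

theorem expectedRevenue_eq_integral (M : Mechanism vbar) {F : Measure (Profile vbar)}
    (hF : Integrable M.revenue F) : M.expectedRevenue F = ((∫ v, M.revenue v ∂F : ℝ) : EReal) := by
  rw [integral_eq_lintegral_pos_part_sub_lintegral_neg_part hF, EReal.coe_sub, expectedRevenue]
  have h1 : ∫⁻ v, ENNReal.ofReal (M.revenue v) ∂F ≠ ⊤ := hF.lintegral_lt_top.ne
  have h2 : ∫⁻ v, ENNReal.ofReal (-M.revenue v) ∂F ≠ ⊤ := hF.neg.lintegral_lt_top.ne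
  rw [← EReal.coe_ennreal_toReal h1, ← EReal.coe_ennreal_toReal h2]

end Mechanism

/-! ### Distributions with given means, and duality with affine minorants -/

section distributions

variable {n : ℕ} {vbar : Fin n → ℝ}

theorem measurable_value (i : Fin n) : Measurable fun v : Profile vbar => (v i : ℝ) :=
  measurable_subtype_coe.comp (measurable_pi_apply i)

theorem integrable_value (F : Measure (Profile vbar)) [IsFiniteMeasure F] (i : Fin n) :
    Integrable (fun v : Profile vbar => (v i : ℝ)) F :=
  Integrable.of_bound (measurable_value i).aestronglyMeasurable (vbar i)
    (Filter.Eventually.of_forall fun v => by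
      rw [Real.norm_eq_abs, abs_of_nonneg (v i).2.1]; exact (v i).2.2)

theorem dirac_mem_distributions (v : Profile vbar) :
    Measure.dirac v ∈ distributions vbar fun i => (v i : ℝ) :=
  ⟨inferInstance, fun i => integral_dirac' _ _ (measurable_value i).stronglyMeasurable⟩

theorem mix_mem_distributions {m m' : Fin n → ℝ} {F F' : Measure (Profile vbar)}
    (hF : F ∈ distributions vbar m) (hF' : F' ∈ distributions vbar m') {a b : ℝ}
    (ha : 0 ≤ a) (hb : 0 ≤ b) (hab : a + b = 1) :
    ENNReal.ofReal a • F + ENNReal.ofReal b • F' ∈ distributions vbar (a • m + b • m') := by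
  obtain ⟨hP, hm⟩ := hF
  obtain ⟨hP', hm'⟩ := hF'
  refine ⟨⟨?_⟩, fun i => ?_⟩
  · simp [← ENNReal.ofReal_add ha hb, hab]
  · rw [integral_add_measure ((integrable_value F i).smul_measure ENNReal.ofReal_ne_top)
      ((integrable_value F' i).smul_measure ENNReal.ofReal_ne_top), integral_smul_measure,
      integral_smul_measure, hm, hm', ENNReal.toReal_ofReal ha, ENNReal.toReal_ofReal hb]
    rfl

/-- A coordinate whose mean is maximal is almost surely maximal. -/
theorem ae_value_eq_of_mean_eq {m : Fin n → ℝ} {F : Measure (Profile vbar)}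
    (hF : F ∈ distributions vbar m) {i : Fin n} (hi : m i = vbar i) :
    ∀ᵐ v ∂F, (v i : ℝ) = vbar i := by
  obtain ⟨hP, hm⟩ := hF
  have h0 : ∫ v, (vbar i - (v i : ℝ)) ∂F = 0 := by
    rw [integral_sub (integrable_const _) (integrable_value F i), hm, hi]; simp
  have h1 := (integral_eq_zero_iff_of_nonneg (fun v => sub_nonneg.2 (v i).2.2)
    ((integrable_const _).sub (integrable_value F i))).1 h0
  filter_upwards [h1] with v hv
  exact (sub_eq_zero.1 hv).symm

namespace Mechanism

/-- Weak duality: an affine function below the revenue bounds the guarantee from below. -/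
theorem le_guarantee (M : Mechanism vbar) {m : Fin n → ℝ} {B : ℝ}
    (hB : ∀ v, |M.revenue v| ≤ B) (c : ℝ) (l : Fin n → ℝ)
    (h : ∀ v : Profile vbar, (∀ i, m i = vbar i → (v i : ℝ) = vbar i) →
      c + ∑ i, l i * (v i : ℝ) ≤ M.revenue v) :
    ((c + ∑ i, l i * m i : ℝ) : EReal) ≤ M.guarantee m := by
  refine le_iInf₂ fun F hF => ?_
  have hF' := hF
  obtain ⟨hP, hm⟩ := hF'
  have hint : Integrable M.revenue F :=
    Integrable.of_bound M.measurable_revenue.aestronglyMeasurable B (Filter.Eventually.of_forall hB)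
  rw [M.expectedRevenue_eq_integral hint, EReal.coe_le_coe_iff]
  have hl : Integrable (fun v : Profile vbar => ∑ i, l i * (v i : ℝ)) F :=
    integrable_finsetSum _ fun i _ => (integrable_value F i).const_mul _
  have heq : c + ∑ i, l i * m i = ∫ v : Profile vbar, (c + ∑ i, l i * (v i : ℝ)) ∂F := by
    rw [integral_add (integrable_const _) hl,
      integral_finsetSum _ fun i _ => (integrable_value F i).const_mul _]
    simp [integral_const_mul, hm]
  rw [heq]
  refine integral_mono_ae ((integrable_const _).add hl) hint ?_
  have hae : ∀ᵐ v ∂F, ∀ i, m i = vbar i → (v i : ℝ) = vbar i :=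
    ae_all_iff.2 fun i => by
      by_cases hi : m i = vbar i
      · filter_upwards [ae_value_eq_of_mean_eq hF hi] with v hv _ using hv
      · exact Filter.Eventually.of_forall fun v h => absurd h hi
  filter_upwards [hae] with v hv using h v hv

open Classical in
/-- Strong duality: a revenue guarantee is witnessed by an affine function below the revenue on the
smallest face of the box that contains the vector of means. -/
theorem exists_affine_minorant {M : Mechanism vbar} (hM : M.IsEPIR) (hv : ∀ i, 0 < vbar i)
    {m : Fin n → ℝ} (hm : ∀ i, m i ∈ Set.Icc (0 : ℝ) (vbar i)) {G : ℝ}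
    (hG : (G : EReal) ≤ M.guarantee m) :
    ∃ (c : ℝ) (l : Fin n → ℝ), (∀ i, m i = 0 ∨ m i = vbar i → l i = 0) ∧
      (∀ v : Profile vbar, (∀ i, m i = 0 ∨ m i = vbar i → (v i : ℝ) = m i) →
        c + ∑ i, l i * (v i : ℝ) ≤ M.revenue v) ∧ c + ∑ i, l i * m i = G := by
  set bd : Fin n → Prop := fun i => m i = 0 ∨ m i = vbar i with hbd
  -- Coordinates with a boundary mean are frozen by `π` and enter `C` only as free dummies. Thus `C`
  -- has interior points even for `m` on the boundary, and `m'` is an interior stand-in for `m`.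
  set π : (Fin n → ℝ) → Fin n → ℝ := fun p i => if bd i then m i else p i with hπ
  set m' : Fin n → ℝ := fun i => if bd i then vbar i / 2 else m i with hm'
  have hπm : π m' = m := by
    ext i; by_cases hi : bd i <;> simp [hπ, hm', hi]
  set C : Set ((Fin n → ℝ) × ℝ) := {q | ∃ F ∈ distributions vbar (π q.1),
    Integrable M.revenue F ∧ ∫ v, M.revenue v ∂F ≤ q.2} with hC
  have hconv : Convex ℝ C := by
    rintro q ⟨F, hF, hFi, hFr⟩ q' ⟨F', hF', hFi', hFr'⟩ a b ha hb hab
    have hj := hFi.smul_measure (c := ENNReal.ofReal a) ENNReal.ofReal_ne_top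
    have hj' := hFi'.smul_measure (c := ENNReal.ofReal b) ENNReal.ofReal_ne_top
    refine ⟨ENNReal.ofReal a • F + ENNReal.ofReal b • F', ?_, hj.add_measure hj', ?_⟩
    · have : π (a • q + b • q').1 = a • π q.1 + b • π q'.1 := by
        ext i
        by_cases hi : bd i
        · simp [hπ, hi, ← add_mul, hab]
        · simp [hπ, hi]
      rw [this]
      exact mix_mem_distributions hF hF' ha hb hab
    · rw [integral_add_measure hj hj', integral_smul_measure, integral_smul_measure,
        ENNReal.toReal_ofReal ha, ENNReal.toReal_ofReal hb]
      exact add_le_add (mul_le_mul_of_nonneg_left hFr ha) (mul_le_mul_of_nonneg_left hFr' hb)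
  have hdirac : ∀ (p : Fin n → ℝ) (v : Profile vbar) (y : ℝ), (∀ i, (v i : ℝ) = π p i) →
      M.revenue v ≤ y → (p, y) ∈ C := by
    intro p v y hpv hy
    refine ⟨Measure.dirac v, ?_, ?_, ?_⟩
    · have := dirac_mem_distributions v
      rwa [funext hpv] at this
    · exact (integrable_const (M.revenue v)).congr
        ((ae_dirac_iff (measurableSet_eq_fun measurable_const M.measurable_revenue)).2 rfl)
    · rw [integral_dirac' _ _ M.measurable_revenue.stronglyMeasurable]; exact hy
  have hopen : (Set.univ.pi fun i => Set.Ioo 0 (vbar i)) ×ˢ Set.Ioi (∑ i, vbar i)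
      ⊆ interior C := by
    refine interior_maximal ?_ ((isOpen_set_pi Set.finite_univ fun i _ => isOpen_Ioo).prod
      isOpen_Ioi)
    rintro ⟨p, y⟩ ⟨hp, hy⟩
    refine hdirac p (fun i => ⟨π p i, ?_⟩) y (fun i => rfl)
      ((hM.revenue_le_sum _).trans (le_of_lt hy))
    by_cases hi : bd i
    · simpa [hπ, hi] using hm i
    · simpa [hπ, hi] using Set.Ioo_subset_Icc_self (hp i trivial)
  have hm'mem : m' ∈ Set.univ.pi fun i => Set.Ioo 0 (vbar i) := by
    intro i _
    by_cases hi : bd i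
    · simp only [hm', hi, if_true]; constructor <;> linarith [hv i]
    · simp only [hm', hi, if_false]
      simp only [hbd, not_or] at hi
      exact ⟨lt_of_le_of_ne (hm i).1 (Ne.symm hi.1), lt_of_le_of_ne (hm i).2 hi.2⟩
  -- An interior point could be lowered to `(m', η)` with `η < G`, giving a distribution with
  -- revenue below the guarantee.
  have hx0 : (m', G) ∉ interior C := by
    intro hmem
    have hcont : Continuous fun η : ℝ => (m', η) := by fun_prop
    have hev : ∀ᶠ η in nhds G, (m', η) ∈ interior C :=
      hcont.continuousAt.eventually_mem (isOpen_interior.mem_nhds hmem)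
    obtain ⟨η, hηC, hη⟩ :=
      ((hev.filter_mono nhdsWithin_le_nhds).and (self_mem_nhdsWithin (s := Set.Iio G))).exists
    obtain ⟨F, hF, hFi, hFr⟩ := interior_subset hηC
    rw [hπm] at hF
    have h1 : (G : EReal) ≤ M.expectedRevenue F := hG.trans (iInf₂_le F hF)
    rw [M.expectedRevenue_eq_integral hFi, EReal.coe_le_coe_iff] at h1
    have : η < G := hη
    simp only at hFr
    linarith
  obtain ⟨f, hf⟩ := geometric_hahn_banach_point_open hconv.interior isOpen_interior hx0
  have hfC : ∀ q ∈ C, f (m', G) ≤ f q := by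
    intro q hq
    have hne : (interior C).Nonempty :=
      ⟨(m', ∑ i, vbar i + 1), hopen ⟨hm'mem, by simp⟩⟩
    have hq' := subset_closure hq
    rw [← hconv.closure_interior_eq_closure_of_nonempty_interior hne] at hq'
    exact closure_minimal (fun b hb => (hf b hb).le)
      (isClosed_le continuous_const f.continuous) hq'
  set κ : ℝ := f (0, 1) with hκ
  set a : Fin n → ℝ := fun i => f (Pi.single i 1, 0) with ha
  have hfe : ∀ p y, f (p, y) = ∑ i, a i * p i + κ * y := by
    intro p y
    have h1 : ((p, y) : (Fin n → ℝ) × ℝ) =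
        ∑ i, p i • ((Pi.single i 1 : Fin n → ℝ), (0 : ℝ)) + y • ((0 : Fin n → ℝ), (1 : ℝ)) := by
      refine Prod.ext ?_ ?_
      · ext j
        simp [Prod.fst_sum, Finset.sum_apply, Pi.single_apply]
      · simp [Prod.snd_sum]
    rw [h1, map_add, map_sum]
    simp only [map_smul, smul_eq_mul, ha, hκ]
    congr 1
    · exact Finset.sum_congr rfl fun i _ => mul_comm _ _
    · exact mul_comm _ _
  -- The separating hyperplane is not vertical, because the interior of `C` contains points straight
  -- above `(m', G)`.
  have hκpos : 0 < κ := by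
    have h1 := hf (m', max (∑ i, vbar i) G + 1)
      (hopen ⟨hm'mem, Set.mem_Ioi.2 (lt_of_le_of_lt (le_max_left _ _) (lt_add_one _))⟩)
    rw [hfe, hfe] at h1
    have h2 : G ≤ max (∑ i, vbar i) G := le_max_right _ _
    by_contra hneg
    nlinarith
  refine ⟨G - ∑ i, (if bd i then 0 else -(a i) / κ) * m i,
    fun i => if bd i then 0 else -(a i) / κ, fun i hi => if_pos hi, fun v hvf => ?_, by ring⟩
  have h1 := hfC (fun i => if bd i then vbar i / 2 else (v i : ℝ), M.revenue v)
    (hdirac _ v _ (fun i => by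
      by_cases hi : bd i
      · simp [hπ, hi, hvf i hi]
      · simp [hπ, hi]) le_rfl)
  rw [hfe, hfe] at h1
  have h2 : κ * (∑ i, (if bd i then 0 else -(a i) / κ) * (v i : ℝ)
      - ∑ i, (if bd i then 0 else -(a i) / κ) * m i)
      = ∑ i, a i * m' i - ∑ i, a i * (if bd i then vbar i / 2 else (v i : ℝ)) := by
    rw [← Finset.sum_sub_distrib, ← Finset.sum_sub_distrib, Finset.mul_sum]
    refine Finset.sum_congr rfl fun i _ => ?_
    by_cases hi : bd i
    · simp [hi, hm']
    · simp only [hi, hm', if_false]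
      field_simp
      ring
  have h3 : κ * (G - ∑ i, (if bd i then 0 else -(a i) / κ) * m i
      + ∑ i, (if bd i then 0 else -(a i) / κ) * (v i : ℝ)) ≤ κ * M.revenue v := by
    linarith
  exact le_of_mul_le_mul_left h3 hκpos

end Mechanism

end distributions

/-! ### Attainable affine functions: compactness and reserve prices -/

/-- The affine function `c + l0 * x + l1 * y` can be secured on the box `[0, b0] × [0, b1]` beyond
the level `κ`: wherever it exceeds `κ`, one of the two bidders is able to pay the value it takes
once this bidder's type is raised to the maximum. -/
structure IsAttainable (b0 b1 κ c l0 l1 : ℝ) : Prop where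
  nonneg0 : 0 ≤ l0
  nonneg1 : 0 ≤ l1
  cover : ∀ x ∈ Set.Icc 0 b0, ∀ y ∈ Set.Icc 0 b1, κ < c + l0 * x + l1 * y →
    c + l0 * b0 + l1 * y ≤ x ∨ c + l0 * x + l1 * b1 ≤ y

theorem isAttainable_const (b0 b1 κ : ℝ) : IsAttainable b0 b1 κ κ 0 0 :=
  ⟨le_rfl, le_rfl, fun _ _ _ _ h => by simp at h⟩

/-- For fixed `(x, y)` the implication in `cover` is a union of three closed half-spaces of
coefficients. -/
theorem isClosed_isAttainable (b0 b1 κ : ℝ) :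
    IsClosed {q : ℝ × ℝ × ℝ | IsAttainable b0 b1 κ q.1 q.2.1 q.2.2} := by
  have heq : {q : ℝ × ℝ × ℝ | IsAttainable b0 b1 κ q.1 q.2.1 q.2.2} =
      {q | 0 ≤ q.2.1} ∩ ({q | 0 ≤ q.2.2} ∩
        ⋂ x ∈ Set.Icc (0 : ℝ) b0, ⋂ y ∈ Set.Icc (0 : ℝ) b1,
          ({q : ℝ × ℝ × ℝ | q.1 + q.2.1 * x + q.2.2 * y ≤ κ} ∪
          ({q | q.1 + q.2.1 * b0 + q.2.2 * y ≤ x} ∪ {q | q.1 + q.2.1 * x + q.2.2 * b1 ≤ y}))) := by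
    ext q
    simp only [Set.mem_inter_iff, Set.mem_iInter, Set.mem_union, Set.mem_ofPred_eq]
    constructor
    · rintro ⟨h0, h1, h⟩
      exact ⟨h0, h1, fun x hx y hy => (le_or_gt _ κ).imp_right (h x hx y hy)⟩
    · rintro ⟨h0, h1, h⟩
      exact ⟨h0, h1, fun x hx y hy hlt => (h x hx y hy).resolve_left (not_le.2 hlt)⟩
  rw [heq]
  refine (isClosed_le (by fun_prop) (by fun_prop)).inter
    ((isClosed_le (by fun_prop) (by fun_prop)).inter ?_)
  refine isClosed_biInter fun x _ => isClosed_biInter fun y _ => ?_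
  exact (isClosed_le (by fun_prop) (by fun_prop)).union
    ((isClosed_le (by fun_prop) (by fun_prop)).union (isClosed_le (by fun_prop) (by fun_prop)))

/-- Among the attainable affine functions there is one with the largest value at `(m0, m1)`. -/
theorem exists_maximal_isAttainable {b0 b1 κ m0 m1 : ℝ}
    (hm0 : 0 ≤ m0) (hm1 : 0 ≤ m1) (hlt0 : m0 < b0) (hle1 : m1 ≤ b1) :
    ∃ c l0 l1, IsAttainable b0 b1 κ c l0 l1 ∧ (m1 = b1 → l1 = 0) ∧
      ∀ c' l0' l1', IsAttainable b0 b1 κ c' l0' l1' → (m1 = b1 → l1' = 0) →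
        c' + l0' * m0 + l1' * m1 ≤ c + l0 * m0 + l1 * m1 := by
  set B := max κ (max b0 b1) with hB
  -- Demanding at least the value `κ` at `(m0, m1)`, which the constant `κ` achieves, bounds the
  -- slopes, since attainability caps the value at `(b0, b1)` by `B`.
  set S : Set (ℝ × ℝ × ℝ) := {q | IsAttainable b0 b1 κ q.1 q.2.1 q.2.2} ∩
    ({q | m1 = b1 → q.2.2 = 0} ∩ {q | κ ≤ q.1 + q.2.1 * m0 + q.2.2 * m1}) with hS
  have hclosed : IsClosed S := by
    refine (isClosed_isAttainable b0 b1 κ).inter (IsClosed.inter ?_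
      (isClosed_le (by fun_prop) (by fun_prop)))
    by_cases h : m1 = b1
    · simpa [h] using isClosed_eq (f := fun q : ℝ × ℝ × ℝ => q.2.2) (g := fun _ => 0)
        (by fun_prop) (by fun_prop)
    · simp [h]
  set K0 := (B - κ) / (b0 - m0) with hK0
  -- For `m1 = b1` division by zero makes this `0`, in line with the constraint `l1 = 0`.
  set K1 := (B - κ) / (b1 - m1) with hK1
  have hsub : S ⊆ Set.Icc (κ - K0 * m0 - K1 * m1) B ×ˢ (Set.Icc 0 K0 ×ˢ Set.Icc 0 K1) := by
    rintro ⟨c, l0, l1⟩ ⟨⟨h0, h1, hcov⟩, hz, hκ⟩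
    simp only [Set.mem_ofPred_eq] at h0 h1 hcov hz hκ
    have htop : c + l0 * b0 + l1 * b1 ≤ B := by
      rcases le_or_gt (c + l0 * b0 + l1 * b1) κ with h | h
      · exact h.trans (le_max_left _ _)
      · rcases hcov b0 ⟨hm0.trans hlt0.le, le_rfl⟩ b1 ⟨hm1.trans hle1, le_rfl⟩ h with h | h
        · exact h.trans ((le_max_left _ _).trans (le_max_right _ _))
        · exact h.trans ((le_max_right _ _).trans (le_max_right _ _))
    have p0 : 0 ≤ l0 * (b0 - m0) := mul_nonneg h0 (by linarith)
    have p1 : 0 ≤ l1 * (b1 - m1) := mul_nonneg h1 (by linarith)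
    have hl0 : l0 ≤ K0 := by
      rw [hK0, le_div_iff₀ (by linarith)]; linarith
    have hl1 : l1 ≤ K1 := by
      rcases hle1.eq_or_lt with h | h
      · rw [hz h, hK1, h]; simp
      · rw [hK1, le_div_iff₀ (by linarith)]; linarith
    have q0 : 0 ≤ l0 * m0 := mul_nonneg h0 hm0
    have q1 : 0 ≤ l1 * m1 := mul_nonneg h1 hm1
    have r0 := mul_le_mul_of_nonneg_right hl0 hm0
    have r1 := mul_le_mul_of_nonneg_right hl1 hm1
    exact ⟨⟨by simp only; linarith, by simp only; linarith⟩, ⟨h0, hl0⟩, ⟨h1, hl1⟩⟩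
  have hcomp : IsCompact S :=
    (isCompact_Icc.prod (isCompact_Icc.prod isCompact_Icc)).of_isClosed_subset hclosed hsub
  have hne : S.Nonempty := ⟨(κ, 0, 0), isAttainable_const b0 b1 κ, fun _ => rfl, by simp⟩
  obtain ⟨⟨c, l0, l1⟩, ⟨hatt, hz, hκ⟩, hmax⟩ := hcomp.exists_isMaxOn hne
    (f := fun q : ℝ × ℝ × ℝ => q.1 + q.2.1 * m0 + q.2.2 * m1) (by fun_prop)
  refine ⟨c, l0, l1, hatt, hz, fun c' l0' l1' hatt' hz' => ?_⟩
  rcases le_or_gt κ (c' + l0' * m0 + l1' * m1) with h | h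
  · exact hmax (show (c', l0', l1') ∈ S from ⟨hatt', hz', h⟩)
  · exact h.le.trans hκ

/-- The reserve prices `r0`, `r1` and the end point `(t, b1)` of the line of equal scores for a
linear score auction that secures an attainable affine function. -/
theorem IsAttainable.exists_reserves {b0 b1 c l0 l1 : ℝ} (h : IsAttainable b0 b1 0 c l0 l1)
    (hb1 : 0 < b1) (hle : b1 ≤ b0) (htop : 0 < c + l0 * b0 + l1 * b1) :
    ∃ r0 r1 t, 0 ≤ r0 ∧ r0 < t ∧ t ≤ b0 ∧ 0 ≤ r1 ∧ r1 < b1 ∧ c + l0 * r0 + l1 * r1 ≤ 0 ∧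
      c + l0 * b0 + l1 * r1 ≤ r0 ∧ c + l0 * r0 + l1 * b1 ≤ r1 ∧
      c + l0 * t + l1 * b1 ≤ b1 ∧ c + l0 * b0 + l1 * b1 ≤ t := by
  obtain ⟨h0, h1, hcov⟩ := h
  have hb0 : 0 < b0 := hb1.trans_le hle
  -- `X` solves `l0 * (b0 - X) = X`, and `Y` likewise, so at `(X, Y)` either alternative of `cover`
  -- says that the function is at most `0`.
  set X := l0 * b0 / (1 + l0) with hX
  set Y := l1 * b1 / (1 + l1) with hY
  have eX : X * (1 + l0) = l0 * b0 := div_mul_cancel₀ _ (by positivity)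
  have eY : Y * (1 + l1) = l1 * b1 := div_mul_cancel₀ _ (by positivity)
  have X0 : 0 ≤ X := by positivity
  have Y0 : 0 ≤ Y := by positivity
  have Xb : X < b0 := by rw [hX, div_lt_iff₀ (by positivity)]; nlinarith
  have Yb : Y < b1 := by rw [hY, div_lt_iff₀ (by positivity)]; nlinarith
  have hXY : c + l0 * X + l1 * Y ≤ 0 := by
    by_contra! hpos
    rcases hcov X ⟨X0, Xb.le⟩ Y ⟨Y0, Yb.le⟩ hpos with h | h <;> linarith
  -- `τ` locates the zero of the function on the segment from `(X, Y)` to `(b0, b1)`. Moving up from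
  -- `(X, Y)` keeps `l0 * (b0 - r0) ≤ r0` and its analogue, whence `hA` and `hB`.
  set d := (c + l0 * b0 + l1 * b1) - (c + l0 * X + l1 * Y) with hd
  have dpos : 0 < d := by linarith
  set τ := -(c + l0 * X + l1 * Y) / d with hτ
  have eτ : τ * d = -(c + l0 * X + l1 * Y) := div_mul_cancel₀ _ dpos.ne'
  have τ0 : 0 ≤ τ := div_nonneg (by linarith) dpos.le
  have τ1 : τ < 1 := by rw [hτ, div_lt_one dpos]; linarith
  set r0 := X + τ * (b0 - X) with hr0
  set r1 := Y + τ * (b1 - Y) with hr1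
  have er : c + l0 * r0 + l1 * r1 = 0 := by rw [hr0, hr1]; linear_combination eτ
  have hX0 : X ≤ r0 := by nlinarith
  have hY1 : Y ≤ r1 := by nlinarith
  have hr0b : r0 < b0 := by nlinarith
  have hr1b : r1 < b1 := by nlinarith
  have hA : c + l0 * b0 + l1 * r1 ≤ r0 := by nlinarith
  have hB : c + l0 * r0 + l1 * b1 ≤ r1 := by nlinarith
  rcases le_or_gt (c + l0 * b0 + l1 * b1) b1 with hc | hc
  · exact ⟨r0, r1, b0, by linarith, hr0b, le_rfl, by linarith, hr1b, er.le, hA, hB, hc,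
      hc.trans hle⟩
  · have l0pos : 0 < l0 := by
      rcases h0.eq_or_lt with h | h
      · rw [← h] at hB hc; linarith
      · exact h
    -- At `(t, b1)` the function equals `b1`. To the right of it on the top edge the second
    -- alternative of `cover` fails, so the first holds and passes to the limit `t`.
    set t := b0 - (c + l0 * b0 + l1 * b1 - b1) / l0 with ht
    have et : c + l0 * t + l1 * b1 = b1 := by
      rw [ht]; field_simp; ring
    have htb : t ≤ b0 := by
      have : 0 ≤ (c + l0 * b0 + l1 * b1 - b1) / l0 := div_nonneg (by linarith) h0
      linarith
    have hrt : r0 < t := by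
      by_contra! hcon
      have := mul_le_mul_of_nonneg_left hcon h0
      linarith
    refine ⟨r0, r1, t, by linarith, hrt, htb, by linarith, hr1b, er.le, hA, hB, et.le, ?_⟩
    have htb' : t < b0 := by
      by_contra! hcon
      have := mul_le_mul_of_nonneg_left hcon h0
      linarith
    refine le_of_forall_gt_imp_ge_of_dense fun x hx => ?_
    rcases le_or_gt x b0 with hxb | hxb
    · have hlx := mul_lt_mul_of_pos_left hx l0pos
      rcases hcov x ⟨by linarith, hxb⟩ b1 ⟨hb1.le, le_rfl⟩ (by linarith) with h | h
      · exact h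
      · linarith
    · rcases hcov b0 ⟨hb0.le, le_rfl⟩ b1 ⟨hb1.le, le_rfl⟩ htop with h | h <;> linarith

/-- The reserve price for the first bidder when the second bidder always accepts the price `b1`. -/
theorem IsAttainable.exists_reserve {b0 b1 c l0 : ℝ} (h : IsAttainable b0 b1 b1 c l0 0)
    (hb1 : 0 < b1) (hle : b1 ≤ b0) :
    ∃ r0 ∈ Set.Icc 0 b0, c + l0 * r0 ≤ b1 ∧ c + l0 * b0 ≤ r0 := by
  obtain ⟨h0, -, hcov⟩ := h
  have hcov' : ∀ x ∈ Set.Icc 0 b0, b1 < c + l0 * x → c + l0 * b0 ≤ x := by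
    intro x hx hlt
    rcases hcov x hx b1 ⟨hb1.le, le_rfl⟩ (by linarith) with h | h <;> linarith
  have hb0 : 0 < b0 := hb1.trans_le hle
  rcases le_or_gt (c + l0 * b0) b1 with hc | hc
  · exact ⟨b0, ⟨hb0.le, le_rfl⟩, hc, hc.trans hle⟩
  have hc0 : c ≤ b1 := by
    by_contra! hcon
    have := hcov' 0 ⟨le_rfl, hb0.le⟩ (by linarith)
    linarith
  have l0pos : 0 < l0 := by
    rcases h0.eq_or_lt with h | h
    · rw [← h] at hc; linarith
    · exact h
  set t := (b1 - c) / l0 with ht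
  have et : l0 * t = b1 - c := mul_div_cancel₀ _ l0pos.ne'
  have htb : t < b0 := by
    by_contra! hcon
    have := mul_le_mul_of_nonneg_left hcon h0
    linarith
  have ht0 : 0 ≤ t := div_nonneg (by linarith) h0
  refine ⟨t, ⟨ht0, htb.le⟩, by linarith, ?_⟩
  refine le_of_forall_gt_imp_ge_of_dense fun x hx => ?_
  rcases le_or_gt x b0 with hxb | hxb
  · have hlx := mul_lt_mul_of_pos_left hx l0pos
    exact hcov' x ⟨by linarith, hxb⟩ (by linarith)
  · have := hcov' b0 ⟨hb0.le, le_rfl⟩ hc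
    linarith

/-! ### Two bidders: score thresholds and value profiles -/

variable {vbar : Fin 2 → ℝ}

theorem scoreToBeat_zero (α β : Fin 2 → ℝ) (v : Profile vbar) :
    scoreToBeat α β v 0 = max (score α β v 1) 0 := by
  have : (Finset.univ : Finset (Fin 2)).erase 0 = {1} := by decide
  rw [scoreToBeat, this, Finset.fold_singleton]

theorem scoreToBeat_one (α β : Fin 2 → ℝ) (v : Profile vbar) :
    scoreToBeat α β v 1 = max (score α β v 0) 0 := by
  have : (Finset.univ : Finset (Fin 2)).erase 1 = {0} := by decide
  rw [scoreToBeat, this, Finset.fold_singleton]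

/-- The value profile `(x, y)`. -/
def profile {x y : ℝ} (hx : x ∈ Set.Icc 0 (vbar 0)) (hy : y ∈ Set.Icc 0 (vbar 1)) :
    Profile vbar := fun i => ⟨![x, y] i, by fin_cases i <;> simpa⟩

@[simp] theorem profile_zero {x y : ℝ} (hx : x ∈ Set.Icc 0 (vbar 0))
    (hy : y ∈ Set.Icc 0 (vbar 1)) : (profile hx hy 0 : ℝ) = x := rfl

@[simp] theorem profile_one {x y : ℝ} (hx : x ∈ Set.Icc 0 (vbar 0))
    (hy : y ∈ Set.Icc 0 (vbar 1)) : (profile hx hy 1 : ℝ) = y := rfl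

theorem update_profile_zero {x y w : ℝ} (hx : x ∈ Set.Icc 0 (vbar 0))
    (hy : y ∈ Set.Icc 0 (vbar 1)) (hw : w ∈ Set.Icc 0 (vbar 0)) :
    Function.update (profile hx hy) 0 ⟨w, hw⟩ = profile hw hy := by
  funext i
  fin_cases i <;> rfl

theorem update_profile_one {x y w : ℝ} (hx : x ∈ Set.Icc 0 (vbar 0))
    (hy : y ∈ Set.Icc 0 (vbar 1)) (hw : w ∈ Set.Icc 0 (vbar 1)) :
    Function.update (profile hx hy) 1 ⟨w, hw⟩ = profile hx hw := by
  funext i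
  fin_cases i <;> rfl

namespace Mechanism

/-! ### Necessity: minorants of feasible revenue are attainable -/

section Feasible

variable {M : Mechanism vbar}

theorem alloc_one_of_alloc_zero {v : Profile vbar} (h : M.alloc 0 v = 1) : M.alloc 1 v = 0 := by
  have := M.sum_alloc_le v
  rw [Fin.sum_univ_two, h] at this
  linarith [M.alloc_nonneg 1 v]

theorem alloc_zero_of_alloc_one {v : Profile vbar} (h : M.alloc 1 v = 1) : M.alloc 0 v = 0 := by
  have := M.sum_alloc_le v
  rw [Fin.sum_univ_two, h] at this
  linarith [M.alloc_nonneg 0 v]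

theorem IsEPIR.pay_nonpos (h : M.IsEPIR) {i : Fin 2} {v : Profile vbar} (hx : M.alloc i v = 0) :
    M.pay i v ≤ 0 := by
  have := h.pay_le i v
  rwa [hx, mul_zero] at this

theorem IsEPIR.revenue_le_pay_zero (h : M.IsEPIR) {v : Profile vbar} (hx : M.alloc 1 v = 0) :
    M.revenue v ≤ M.pay 0 v := by
  rw [revenue, Fin.sum_univ_two]; linarith [h.pay_nonpos hx]

theorem IsEPIR.revenue_le_pay_one (h : M.IsEPIR) {v : Profile vbar} (hx : M.alloc 0 v = 0) :
    M.revenue v ≤ M.pay 1 v := by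
  rw [revenue, Fin.sum_univ_two]; linarith [h.pay_nonpos hx]

theorem IsEPIR.revenue_nonpos (h : M.IsEPIR) {v : Profile vbar} (h0 : M.alloc 0 v = 0)
    (h1 : M.alloc 1 v = 0) : M.revenue v ≤ 0 :=
  (h.revenue_le_pay_one h0).trans (h.pay_nonpos h1)

theorem IsEPIR.revenue_le (h : M.IsEPIR) (hle : vbar 1 ≤ vbar 0) (v : Profile vbar) :
    M.revenue v ≤ vbar 0 := by
  rcases M.alloc_eq 0 v with h0 | h0
  · exact (h.revenue_le_pay_one h0).trans ((h.pay_le_value 1 v).trans ((v 1).2.2.trans hle))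
  · exact (h.revenue_le_pay_zero (alloc_one_of_alloc_zero h0)).trans
      ((h.pay_le_value 0 v).trans (v 0).2.2)

/-- If bidder `0` wins, the revenue at her highest value is at most her value. -/
theorem IsFeasible.revenue_zero_le (h : M.IsFeasible) {x y : ℝ} (hx : x ∈ Set.Icc 0 (vbar 0))
    (hy : y ∈ Set.Icc 0 (vbar 1)) (hwin : M.alloc 0 (profile hx hy) = 1)
    (hb : vbar 0 ∈ Set.Icc 0 (vbar 0)) : M.revenue (profile hb hy) ≤ x := by
  have hu := h.1.winner_update (w := ⟨vbar 0, hb⟩) hwin hx.2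
  rw [update_profile_zero] at hu
  calc M.revenue (profile hb hy) ≤ M.pay 0 (profile hb hy) :=
        h.2.revenue_le_pay_zero (alloc_one_of_alloc_zero hu.1)
    _ = M.pay 0 (profile hx hy) := hu.2
    _ ≤ x := h.2.pay_le_value 0 (profile hx hy)

/-- If bidder `1` wins, the revenue at her highest value is at most her value. -/
theorem IsFeasible.revenue_one_le (h : M.IsFeasible) {x y : ℝ} (hx : x ∈ Set.Icc 0 (vbar 0))
    (hy : y ∈ Set.Icc 0 (vbar 1)) (hwin : M.alloc 1 (profile hx hy) = 1)
    (hb : vbar 1 ∈ Set.Icc 0 (vbar 1)) : M.revenue (profile hx hb) ≤ y := by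
  have hu := h.1.winner_update (w := ⟨vbar 1, hb⟩) hwin hy.2
  rw [update_profile_one] at hu
  calc M.revenue (profile hx hb) ≤ M.pay 1 (profile hx hb) :=
        h.2.revenue_le_pay_one (alloc_zero_of_alloc_one hu.1)
    _ = M.pay 1 (profile hx hy) := hu.2
    _ ≤ y := h.2.pay_le_value 1 (profile hx hy)

/-- Affine functions below the revenue of a feasible mechanism are attainable once their negative
slopes are replaced by zero. -/
theorem IsFeasible.isAttainable (h : M.IsFeasible) (hpos : ∀ i, 0 < vbar i) {m : Fin 2 → ℝ}
    {c : ℝ} {l : Fin 2 → ℝ} (hl : ∀ i, m i = 0 → l i = 0)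
    (hmin : ∀ v : Profile vbar, (∀ i, m i = 0 → (v i : ℝ) = 0) →
      c + l 0 * v 0 + l 1 * v 1 ≤ M.revenue v) :
    IsAttainable (vbar 0) (vbar 1) 0 c (max (l 0) 0) (max (l 1) 0) := by
  refine ⟨le_max_right _ _, le_max_right _ _, fun x hx y hy hlt => ?_⟩
  have hb0 : vbar 0 ∈ Set.Icc 0 (vbar 0) := ⟨(hpos 0).le, le_rfl⟩
  have hb1 : vbar 1 ∈ Set.Icc 0 (vbar 1) := ⟨(hpos 1).le, le_rfl⟩
  -- The truncated function at `(x, y)` is the original one at `(x', y')`, where a coordinate with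
  -- nonpositive slope is set to `0`; this also respects the face `m i = 0`.
  have key : ∀ k b : ℝ, b ∈ Set.Icc 0 b → ∀ z ∈ Set.Icc 0 b, ∃ z' ∈ Set.Icc 0 b,
      k * z' = max k 0 * z ∧ (k ≤ 0 → z' = 0) ∧ (0 < k → z' = z) := by
    intro k b hb z hz
    rcases le_or_gt k 0 with hk | hk
    · exact ⟨0, ⟨le_rfl, hb.1⟩, by simp [hk], fun _ => rfl, fun h => absurd hk (not_le.2 h)⟩
    · exact ⟨z, hz, by rw [max_eq_left hk.le], fun h => absurd hk (not_lt.2 h), fun _ => rfl⟩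
  obtain ⟨x', hx', ex, x0, xx⟩ := key (l 0) _ hb0 x hx
  obtain ⟨y', hy', ey, y0, yy⟩ := key (l 1) _ hb1 y hy
  have hface0 : m 0 = 0 → x' = 0 := fun hm => x0 (hl 0 hm).le
  have hface1 : m 1 = 0 → y' = 0 := fun hm => y0 (hl 1 hm).le
  have hmv := hmin (profile hx' hy') (by
    intro i; fin_cases i
    · exact hface0
    · exact hface1)
  simp only [profile_zero, profile_one, ex, ey] at hmv
  rcases M.alloc_eq 0 (profile hx' hy') with h0 | h0
  · rcases M.alloc_eq 1 (profile hx' hy') with h1 | h1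
    · linarith [h.2.revenue_nonpos h0 h1]
    -- Positive revenue forces a positive value of the winner, so her coordinate was not reset and
    -- her slope is positive.
    · have hypos : 0 < y' := by
        have := h.2.pay_le_value 1 (profile hx' hy')
        rw [profile_one] at this
        linarith [h.2.revenue_le_pay_one h0]
      have l1pos : 0 < l 1 := by
        by_contra! hcon
        exact hypos.ne' (y0 hcon)
      have hlow := hmin (profile hx' hb1) (by
        intro i; fin_cases i
        · exact hface0
        · exact fun hm => absurd (hl 1 hm) l1pos.ne')
      simp only [profile_zero, profile_one, ex] at hlow
      have hup := h.revenue_one_le hx' hy' h1 hb1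
      rw [max_eq_left l1pos.le, ← yy l1pos]
      exact Or.inr (hlow.trans hup)
  · have hxpos : 0 < x' := by
      have := h.2.pay_le_value 0 (profile hx' hy')
      rw [profile_zero] at this
      linarith [h.2.revenue_le_pay_zero (alloc_one_of_alloc_zero h0)]
    have l0pos : 0 < l 0 := by
      by_contra! hcon
      exact hxpos.ne' (x0 hcon)
    have hlow := hmin (profile hb0 hy') (by
      intro i; fin_cases i
      · exact fun hm => absurd (hl 0 hm) l0pos.ne'
      · exact hface1)
    simp only [profile_zero, profile_one, ey] at hlow
    have hup := h.revenue_zero_le hx' hy' h0 hb0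
    rw [max_eq_left l0pos.le, ← xx l0pos]
    exact Or.inl (hlow.trans hup)

/-- The counterpart of `IsFeasible.isAttainable` when the second bidder's value is `vbar 1`. -/
theorem IsFeasible.isAttainable_of_top (h : M.IsFeasible) (hpos : ∀ i, 0 < vbar i)
    {m0 c l0 : ℝ} (hl : m0 = 0 → l0 = 0)
    (hmin : ∀ v : Profile vbar, (m0 = 0 → (v 0 : ℝ) = 0) → (v 1 : ℝ) = vbar 1 →
      c + l0 * v 0 ≤ M.revenue v) :
    IsAttainable (vbar 0) (vbar 1) (vbar 1) c (max l0 0) 0 := by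
  have hb0 : vbar 0 ∈ Set.Icc 0 (vbar 0) := ⟨(hpos 0).le, le_rfl⟩
  have hb1 : vbar 1 ∈ Set.Icc 0 (vbar 1) := ⟨(hpos 1).le, le_rfl⟩
  refine ⟨le_max_right _ _, le_rfl, fun x hx y hy hlt => Or.inl ?_⟩
  simp only [zero_mul, add_zero] at hlt ⊢
  have hwin : ∀ (z : ℝ) (hz : z ∈ Set.Icc 0 (vbar 0)),
      vbar 1 < M.revenue (profile hz hb1) → M.alloc 0 (profile hz hb1) = 1 := by
    intro z hz hr
    refine (M.alloc_eq 0 _).resolve_left fun h0 => ?_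
    exact absurd ((h.2.revenue_le_pay_one h0).trans
      (h.2.pay_le_value 1 _)) (not_le.2 (by simpa using hr))
  -- With a nonpositive slope, bidder `0` would have to win at value `0` and pay more than `vbar 1`.
  rcases le_or_gt l0 0 with hl0 | hl0
  · rw [max_eq_right hl0, zero_mul, add_zero] at hlt
    have h00 : (0 : ℝ) ∈ Set.Icc 0 (vbar 0) := ⟨le_rfl, (hpos 0).le⟩
    have hm := hmin (profile h00 hb1) (fun _ => rfl) rfl
    simp only [profile_zero, mul_zero, add_zero] at hm
    have hw := hwin 0 h00 (hlt.trans_le hm)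
    have hp := h.2.pay_le_value 0 (profile h00 hb1)
    rw [profile_zero] at hp
    linarith [h.2.revenue_le_pay_zero (alloc_one_of_alloc_zero hw), hpos 1]
  · rw [max_eq_left hl0.le] at hlt ⊢
    have hm := hmin (profile hx hb1) (fun h => absurd (hl h) hl0.ne') rfl
    rw [profile_zero] at hm
    have hm' := hmin (profile hb0 hb1) (fun h => absurd (hl h) hl0.ne') rfl
    rw [profile_zero] at hm'
    exact hm'.trans (h.revenue_zero_le hx hb1 (hwin x hx (hlt.trans_le hm)) hb0)

end Feasible

/-! ### Sufficiency: linear score auctions secure attainable functions -/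

section LinearScore

open Classical in
/-- The linear score auction with scores `γ * (v 0 - r 0)` and `v 1 - r 1` and threshold payments.
A bidder with score zero may win, and bidder `0` wins ties. -/
def linearScore (vbar : Fin 2 → ℝ) (r0 r1 γ : ℝ) : Mechanism vbar where
  alloc := ![fun v => if r0 ≤ (v 0 : ℝ) ∧ (v 1 : ℝ) - r1 ≤ γ * ((v 0 : ℝ) - r0) then 1 else 0,
    fun v => if r1 ≤ (v 1 : ℝ) ∧ γ * ((v 0 : ℝ) - r0) < (v 1 : ℝ) - r1 then 1 else 0]
  pay := ![fun v => if r0 ≤ (v 0 : ℝ) ∧ (v 1 : ℝ) - r1 ≤ γ * ((v 0 : ℝ) - r0) then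
      max r0 (r0 + ((v 1 : ℝ) - r1) / γ) else 0,
    fun v => if r1 ≤ (v 1 : ℝ) ∧ γ * ((v 0 : ℝ) - r0) < (v 1 : ℝ) - r1 then
      max r1 (r1 + γ * ((v 0 : ℝ) - r0)) else 0]
  measurable_alloc i := by
    have h0 := measurable_value (vbar := vbar) 0
    have h1 := measurable_value (vbar := vbar) 1
    fin_cases i
    · exact Measurable.ite ((measurableSet_le measurable_const h0).inter
        (measurableSet_le (h1.sub_const _) ((h0.sub_const _).const_mul _)))
        measurable_const measurable_const
    · exact Measurable.ite ((measurableSet_le measurable_const h1).inter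
        (measurableSet_lt ((h0.sub_const _).const_mul _) (h1.sub_const _)))
        measurable_const measurable_const
  measurable_pay i := by
    have h0 := measurable_value (vbar := vbar) 0
    have h1 := measurable_value (vbar := vbar) 1
    fin_cases i
    · exact Measurable.ite ((measurableSet_le measurable_const h0).inter
        (measurableSet_le (h1.sub_const _) ((h0.sub_const _).const_mul _)))
        (measurable_const.max (((h1.sub_const _).div_const _).const_add _)) measurable_const
    · exact Measurable.ite ((measurableSet_le measurable_const h1).inter
        (measurableSet_lt ((h0.sub_const _).const_mul _) (h1.sub_const _)))
        (measurable_const.max (((h0.sub_const _).const_mul _).const_add _)) measurable_const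
  alloc_eq i v := by
    fin_cases i
    · exact (ite_eq_or_eq _ _ _).symm
    · exact (ite_eq_or_eq _ _ _).symm
  sum_alloc_le v := by
    rw [Fin.sum_univ_two]
    simp only [Matrix.cons_val_zero, Matrix.cons_val_one]
    split_ifs with h h'
    · exact absurd h.2 (not_le.2 h'.2)
    all_goals norm_num

variable {r0 r1 γ : ℝ}

theorem linearScore_alloc_zero (v : Profile vbar) : (linearScore vbar r0 r1 γ).alloc 0 v =
    if r0 ≤ (v 0 : ℝ) ∧ (v 1 : ℝ) - r1 ≤ γ * ((v 0 : ℝ) - r0) then 1 else 0 := by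
  simp [linearScore]

theorem linearScore_alloc_one (v : Profile vbar) : (linearScore vbar r0 r1 γ).alloc 1 v =
    if r1 ≤ (v 1 : ℝ) ∧ γ * ((v 0 : ℝ) - r0) < (v 1 : ℝ) - r1 then 1 else 0 := by
  simp [linearScore]

theorem linearScore_pay_zero (v : Profile vbar) : (linearScore vbar r0 r1 γ).pay 0 v =
    if r0 ≤ (v 0 : ℝ) ∧ (v 1 : ℝ) - r1 ≤ γ * ((v 0 : ℝ) - r0) then
      max r0 (r0 + ((v 1 : ℝ) - r1) / γ) else 0 := by
  simp [linearScore]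

theorem linearScore_pay_one (v : Profile vbar) : (linearScore vbar r0 r1 γ).pay 1 v =
    if r1 ≤ (v 1 : ℝ) ∧ γ * ((v 0 : ℝ) - r0) < (v 1 : ℝ) - r1 then
      max r1 (r1 + γ * ((v 0 : ℝ) - r0)) else 0 := by
  simp [linearScore]

theorem linearScore_isFeasible (hγ : 0 < γ) : (linearScore vbar r0 r1 γ).IsFeasible := by
  have e0 : ∀ v : Profile vbar, (v 1 : ℝ) - r1 ≤ γ * ((v 0 : ℝ) - r0) ↔
      r0 + ((v 1 : ℝ) - r1) / γ ≤ v 0 := fun v => by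
    rw [← div_le_iff₀' hγ, le_sub_iff_add_le']
  have hmax0 : ∀ v : Profile vbar, (r0 ≤ (v 0 : ℝ) ∧ (v 1 : ℝ) - r1 ≤ γ * ((v 0 : ℝ) - r0)) ↔
      max r0 (r0 + ((v 1 : ℝ) - r1) / γ) ≤ v 0 := fun v => by
    rw [max_le_iff, e0]
  refine isFeasible_of_threshold
    ![fun v => max r0 (r0 + ((v 1 : ℝ) - r1) / γ), fun v => max r1 (r1 + γ * ((v 0 : ℝ) - r0))]
    ?_ ?_ ?_ ?_ <;> intro i v <;> fin_cases i
  · intro w; simp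
  · intro w; simp
  · simp [linearScore_alloc_zero, linearScore_pay_zero]
  · simp [linearScore_alloc_one, linearScore_pay_one]
  · intro hx
    simp only [Fin.zero_eta, linearScore_alloc_zero, hmax0] at hx
    by_contra hcon
    exact zero_ne_one ((if_neg hcon).symm.trans hx)
  · intro hx
    simp only [Fin.mk_one, linearScore_alloc_one] at hx
    by_contra hcon
    refine zero_ne_one ((if_neg fun hw => hcon ?_).symm.trans hx)
    exact max_le hw.1 (show r1 + γ * ((v 0 : ℝ) - r0) ≤ (v 1 : ℝ) by linarith [hw.2])
  · intro hx
    simp only [Fin.zero_eta, linearScore_alloc_zero, hmax0] at hx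
    by_contra hcon
    exact one_ne_zero ((if_pos (not_le.1 hcon).le).symm.trans hx)
  · intro hx
    simp only [Fin.mk_one, linearScore_alloc_one] at hx
    by_contra hcon
    have hcon' : max r1 (r1 + γ * ((v 0 : ℝ) - r0)) < v 1 := not_le.1 hcon
    obtain ⟨hc1, hc2⟩ := max_lt_iff.1 hcon'
    exact one_ne_zero ((if_pos ⟨hc1.le, by linarith⟩).symm.trans hx)

theorem linearScore_isLSAWith (hγ : 0 < γ) (hr0 : 0 ≤ r0) (hr1 : 0 ≤ r1) :
    (linearScore vbar r0 r1 γ).IsLSAWith ![γ * r0, r1] ![γ, 1] := by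
  refine ⟨linearScore_isFeasible hγ, fun i => ?_, fun i => ?_, fun i v => ?_⟩
  · fin_cases i
    · exact mul_nonneg hγ.le hr0
    · exact hr1
  · fin_cases i
    · exact hγ
    · exact one_pos
  have s0 : score ![γ * r0, r1] ![γ, 1] v 0 = γ * ((v 0 : ℝ) - r0) := by
    simp [score]; ring
  have s1 : score ![γ * r0, r1] ![γ, 1] v 1 = (v 1 : ℝ) - r1 := by
    simp [score]
  fin_cases i
  · simp only [Fin.zero_eta, scoreToBeat_zero, s0, s1, linearScore_alloc_zero, max_lt_iff,
      lt_max_iff]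
    constructor <;> intro h
    · exact if_pos ⟨by linarith [(pos_iff_pos_of_mul_pos h.2).1 hγ], h.1.le⟩
    · refine if_neg fun h' => ?_
      rcases h with h | h
      · linarith [h'.2]
      · nlinarith [h'.1]
  · simp only [Fin.mk_one, scoreToBeat_one, s0, s1, linearScore_alloc_one, max_lt_iff,
      lt_max_iff]
    refine ⟨fun h => if_pos ⟨by linarith [h.2], h.1⟩, fun h => if_neg fun h' => ?_⟩
    rcases h with h | h
    · linarith [h'.2]
    · linarith [h'.1]

theorem linearScore_revenue_nonneg (hr0 : 0 ≤ r0) (hr1 : 0 ≤ r1) (v : Profile vbar) :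
    0 ≤ (linearScore vbar r0 r1 γ).revenue v := by
  rw [revenue, Fin.sum_univ_two, linearScore_pay_zero, linearScore_pay_one]
  refine add_nonneg ?_ ?_ <;> split_ifs
  · exact hr0.trans (le_max_left _ _)
  · exact le_rfl
  · exact hr1.trans (le_max_left _ _)
  · exact le_rfl

theorem linearScore_abs_revenue_le (hγ : 0 < γ) (hr0 : 0 ≤ r0) (hr1 : 0 ≤ r1)
    (v : Profile vbar) : |(linearScore vbar r0 r1 γ).revenue v| ≤ ∑ i, vbar i := by
  rw [abs_of_nonneg (linearScore_revenue_nonneg hr0 hr1 v)]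
  exact (linearScore_isFeasible hγ).2.revenue_le_sum v

theorem linearScore_revenue_of_wins_zero {v : Profile vbar} (h0 : r0 ≤ (v 0 : ℝ))
    (h : (v 1 : ℝ) - r1 ≤ γ * ((v 0 : ℝ) - r0)) :
    (linearScore vbar r0 r1 γ).revenue v = max r0 (r0 + ((v 1 : ℝ) - r1) / γ) := by
  rw [revenue, Fin.sum_univ_two, linearScore_pay_zero, linearScore_pay_one, if_pos ⟨h0, h⟩,
    if_neg fun h' => absurd h'.2 (not_lt.2 h), add_zero]

theorem linearScore_revenue_of_wins_one {v : Profile vbar} (h1 : r1 ≤ (v 1 : ℝ))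
    (h : γ * ((v 0 : ℝ) - r0) < (v 1 : ℝ) - r1) :
    (linearScore vbar r0 r1 γ).revenue v = max r1 (r1 + γ * ((v 0 : ℝ) - r0)) := by
  rw [revenue, Fin.sum_univ_two, linearScore_pay_zero, linearScore_pay_one,
    if_neg fun h' => absurd h (not_lt.2 h'.2), if_pos ⟨h1, h⟩, zero_add]

/-- Every attainable affine function lies below the revenue of some linear score auction. -/
theorem exists_linearScore_ge {c l0 l1 : ℝ} (hpos : 0 < vbar 1) (hle : vbar 1 ≤ vbar 0)
    (h : IsAttainable (vbar 0) (vbar 1) 0 c l0 l1) :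
    ∃ r0 ∈ Set.Icc 0 (vbar 0), ∃ r1 ∈ Set.Icc 0 (vbar 1), ∃ γ, 0 < γ ∧ ∀ v : Profile vbar,
      c + l0 * v 0 + l1 * v 1 ≤ (linearScore vbar r0 r1 γ).revenue v := by
  have h0 := h.nonneg0
  have h1 := h.nonneg1
  rcases le_or_gt (c + l0 * vbar 0 + l1 * vbar 1) 0 with htop | htop
  · have hb0 : 0 ≤ vbar 0 := hpos.le.trans hle
    refine ⟨vbar 0, ⟨hb0, le_rfl⟩, vbar 1, ⟨hpos.le, le_rfl⟩, 1, one_pos, fun v => ?_⟩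
    have hr := linearScore_revenue_nonneg (γ := 1) hb0 hpos.le v
    have p0 := mul_le_mul_of_nonneg_left (v 0).2.2 h0
    have p1 := mul_le_mul_of_nonneg_left (v 1).2.2 h1
    linarith
  obtain ⟨r0, r1, t, hr0, hrt, htb, hr1, hr1b, er, eA, eB, et, eT⟩ :=
    h.exists_reserves hpos hle htop
  have dt : 0 < t - r0 := sub_pos.2 hrt
  have db : 0 < vbar 1 - r1 := sub_pos.2 hr1b
  set γ := (vbar 1 - r1) / (t - r0) with hγ
  have γpos : 0 < γ := div_pos db dt
  have eγ : γ * (t - r0) = vbar 1 - r1 := div_mul_cancel₀ _ dt.ne'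
  refine ⟨r0, ⟨hr0, (hrt.trans_le htb).le⟩, r1, ⟨hr1, hr1b.le⟩, γ, γpos, fun v => ?_⟩
  have hv0 := (v 0).2.2
  have hv1 := (v 1).2.2
  have p0 := mul_le_mul_of_nonneg_left hv0 h0
  have p1 := mul_le_mul_of_nonneg_left hv1 h1
  -- The winner's price is compared with the function at her highest value: by interpolation between
  -- `(r0, r1)` and `(t, vbar 1)` above the reserve of her rival, by `eA` or `eB` below it. Where
  -- nobody wins, `er` and monotonicity make the function nonpositive.
  rcases le_or_gt ((v 1 : ℝ) - r1) (γ * ((v 0 : ℝ) - r0)) with hs | hs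
  · rcases le_or_gt r0 (v 0 : ℝ) with hx | hx
    · rw [linearScore_revenue_of_wins_zero hx hs]
      rcases le_or_gt (v 1 : ℝ) r1 with hy | hy
      · have := mul_le_mul_of_nonneg_left hy h1
        exact le_trans (by linarith) (le_max_left _ _)
      · refine le_trans ?_ (le_max_right _ _)
        set w := ((v 1 : ℝ) - r1) / γ with hw
        have ew : γ * w = (v 1 : ℝ) - r1 := mul_div_cancel₀ _ γpos.ne'
        -- `v 1` is the convex combination of `r1` and `vbar 1` with weight `w / (t - r0)`
        have w0 : 0 ≤ w := div_nonneg (by linarith) γpos.le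
        have w1 : w ≤ t - r0 := by
          by_contra! hcon
          have := mul_lt_mul_of_pos_left hcon γpos
          linarith
        have hcomb : (t - r0) * ((v 1 : ℝ) - r1) = w * (vbar 1 - r1) := by
          rw [← ew, ← eγ]; ring
        have q1 := mul_le_mul_of_nonneg_left eA (sub_nonneg.2 w1)
        have q2 := mul_le_mul_of_nonneg_left eT w0
        have q3 : (t - r0) * (c + l0 * vbar 0 + l1 * v 1) ≤ (t - r0) * (r0 + w) := by
          linear_combination q1 + q2 + l1 * hcomb
        have := le_of_mul_le_mul_left q3 dt
        linarith
    · have hneg : γ * ((v 0 : ℝ) - r0) < 0 := mul_neg_of_pos_of_neg γpos (by linarith)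
      have hr := linearScore_revenue_nonneg (γ := γ) hr0 hr1 v
      have q0 := mul_le_mul_of_nonneg_left hx.le h0
      have q1 := mul_le_mul_of_nonneg_left (show (v 1 : ℝ) ≤ r1 by linarith) h1
      linarith
  · rcases le_or_gt r1 (v 1 : ℝ) with hy | hy
    · rw [linearScore_revenue_of_wins_one hy hs]
      rcases le_or_gt (v 0 : ℝ) r0 with hx | hx
      · have := mul_le_mul_of_nonneg_left hx h0
        exact le_trans (by linarith) (le_max_left _ _)
      · refine le_trans ?_ (le_max_right _ _)
        have w1 : (v 0 : ℝ) - r0 ≤ t - r0 := by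
          by_contra! hcon
          have := mul_lt_mul_of_pos_left hcon γpos
          linarith
        have q1 := mul_le_mul_of_nonneg_left eB (sub_nonneg.2 w1)
        have q2 := mul_le_mul_of_nonneg_left et (sub_nonneg.2 hx.le)
        have q3 : (t - r0) * (c + l0 * v 0 + l1 * vbar 1) ≤
            (t - r0) * (r1 + γ * ((v 0 : ℝ) - r0)) := by
          linear_combination q1 + q2 - ((v 0 : ℝ) - r0) * eγ
        have := le_of_mul_le_mul_left q3 dt
        linarith
    · have hneg : (v 0 : ℝ) < r0 := by
        by_contra! hcon
        have := mul_nonneg γpos.le (sub_nonneg.2 hcon)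
        linarith
      have hr := linearScore_revenue_nonneg (γ := γ) hr0 hr1 v
      have q0 := mul_le_mul_of_nonneg_left hneg.le h0
      have q1 := mul_le_mul_of_nonneg_left hy.le h1
      linarith

end LinearScore

end Mechanism

/-! ### Existence of an optimal linear score auction -/

namespace Mechanism

/-- Guarantees may be `-∞`, so rivals are compared through real lower bounds, the form in which
`exists_affine_minorant` applies. -/
theorem isOptimal_of_forall_le {M : Mechanism vbar} {m : Fin 2 → ℝ} {V : ℝ} (hM : M.IsFeasible)
    (hV : (V : EReal) ≤ M.guarantee m)
    (hub : ∀ M' : Mechanism vbar, M'.IsFeasible → ∀ G : ℝ, (G : EReal) ≤ M'.guarantee m → G ≤ V) :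
    M.IsOptimal m := by
  refine ⟨hM, fun M' hM' => le_trans (EReal.ge_of_forall_gt_iff_ge.1 fun z hz => ?_) hV⟩
  exact EReal.coe_le_coe_iff.2 (hub M' hM' z hz.le)

theorem le_guarantee_linearScore {r0 r1 γ c l0 l1 : ℝ} (hγ : 0 < γ) (hr0 : 0 ≤ r0) (hr1 : 0 ≤ r1)
    {m : Fin 2 → ℝ}
    (h : ∀ v : Profile vbar, (∀ i, m i = vbar i → (v i : ℝ) = vbar i) →
      c + l0 * v 0 + l1 * v 1 ≤ (linearScore vbar r0 r1 γ).revenue v) :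
    ((c + l0 * m 0 + l1 * m 1 : ℝ) : EReal) ≤ (linearScore vbar r0 r1 γ).guarantee m := by
  have := le_guarantee _ (m := m) (linearScore_abs_revenue_le (vbar := vbar) hγ hr0 hr1) c ![l0, l1]
    (fun v hv => by
      simpa [Fin.sum_univ_two, ← add_assoc] using h v hv)
  simpa [Fin.sum_univ_two, ← add_assoc] using this

theorem le_add_of_max {c k0 k1 x y : ℝ} (hx : 0 ≤ x) (hy : 0 ≤ y) :
    c + k0 * x + k1 * y ≤ c + max k0 0 * x + max k1 0 * y := by
  have h0 := mul_le_mul_of_nonneg_right (le_max_left k0 0) hx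
  have h1 := mul_le_mul_of_nonneg_right (le_max_left k1 0) hy
  linarith

/-- For every vector of means some linear score auction is optimal. -/
theorem exists_linearScore_isOptimal (hpos : 0 < vbar 1) (hle : vbar 1 ≤ vbar 0) {m : Fin 2 → ℝ}
    (hm : ∀ i, m i ∈ Set.Icc (0 : ℝ) (vbar i)) :
    ∃ r0 ∈ Set.Icc 0 (vbar 0), ∃ r1 ∈ Set.Icc 0 (vbar 1), ∃ γ, 0 < γ ∧
      (linearScore vbar r0 r1 γ).IsOptimal m := by
  have hpos0 : 0 < vbar 0 := hpos.trans_le hle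
  have hpos' : ∀ i, 0 < vbar i := by
    intro i; fin_cases i
    · exact hpos0
    · exact hpos
  rcases (hm 0).2.eq_or_lt with hm0 | hm0
  · refine ⟨vbar 0, ⟨hpos0.le, le_rfl⟩, vbar 1, ⟨hpos.le, le_rfl⟩, 1, one_pos, ?_⟩
    refine isOptimal_of_forall_le (V := vbar 0 + 0 * m 0 + 0 * m 1) (linearScore_isFeasible one_pos)
      (le_guarantee_linearScore one_pos hpos0.le hpos.le fun v hv => ?_) fun M' hM' G hG => ?_
    · have h0 := hv 0 hm0
      rw [linearScore_revenue_of_wins_zero h0.ge (by rw [h0]; linarith [(v 1).2.2])]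
      simp
    · obtain ⟨c, l, -, hmin, hGm⟩ := exists_affine_minorant hM'.2 hpos' hm hG
      have h1 := hmin (fun i => ⟨m i, hm i⟩) fun i _ => rfl
      simp only at h1
      linarith [hM'.2.revenue_le hle fun i => ⟨m i, hm i⟩]
  rcases (hm 1).2.eq_or_lt with hm1 | hm1
  · obtain ⟨c, l0, l1, hatt, hl1, hmax⟩ := exists_maximal_isAttainable (κ := vbar 1)
      (hm 0).1 (hm 1).1 hm0 (hm 1).2
    obtain rfl := hl1 hm1
    obtain ⟨r0, hr0, hc1, hc2⟩ := hatt.exists_reserve hpos hle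
    -- At her almost sure value `vbar 1` bidder `1` has score zero, so she buys at that price
    -- whenever bidder `0` is below `r0`.
    refine ⟨r0, hr0, vbar 1, ⟨hpos.le, le_rfl⟩, 1, one_pos, isOptimal_of_forall_le
      (V := c + l0 * m 0 + 0 * m 1) (linearScore_isFeasible one_pos)
      (le_guarantee_linearScore one_pos hr0.1 hpos.le fun v hv => ?_) fun M' hM' G hG => ?_⟩
    · have h1 := hv 1 hm1
      rcases le_or_gt r0 (v 0 : ℝ) with hx | hx
      · rw [linearScore_revenue_of_wins_zero hx (by rw [h1]; linarith)]
        have := mul_le_mul_of_nonneg_left (v 0).2.2 hatt.nonneg0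
        exact le_trans (by linarith) (le_max_left _ _)
      · rw [linearScore_revenue_of_wins_one h1.ge (by rw [h1]; linarith)]
        have := mul_le_mul_of_nonneg_left hx.le hatt.nonneg0
        exact le_trans (by linarith) (le_max_left _ _)
    · obtain ⟨k, l, hl, hmin, hGm⟩ := exists_affine_minorant hM'.2 hpos' hm hG
      have hl1 : l 1 = 0 := hl 1 (Or.inr hm1)
      simp only [Fin.sum_univ_two, hl1, zero_mul, add_zero] at hmin hGm
      have hatt' := hM'.isAttainable_of_top hpos' (m0 := m 0) (c := k) (l0 := l 0)
        (fun h => hl 0 (Or.inl h)) (fun v h0 h1 => hmin v (by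
          intro i; fin_cases i
          · rintro (h | h)
            · exact (h0 h).trans h.symm
            · exact absurd h hm0.ne
          · exact fun _ => h1.trans hm1.symm))
      have := hmax _ _ _ hatt' (fun _ => rfl)
      have h2 := le_add_of_max (c := k) (k0 := l 0) (k1 := 0) (hm 0).1 (hm 1).1
      simp only [max_self] at h2
      linarith
  · obtain ⟨c, l0, l1, hatt, -, hmax⟩ := exists_maximal_isAttainable (κ := 0)
      (hm 0).1 (hm 1).1 hm0 (hm 1).2
    obtain ⟨r0, hr0, r1, hr1, γ, hγ, hrev⟩ := exists_linearScore_ge hpos hle hatt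
    refine ⟨r0, hr0, r1, hr1, γ, hγ, isOptimal_of_forall_le (linearScore_isFeasible hγ)
      (le_guarantee_linearScore hγ hr0.1 hr1.1 fun v _ => hrev v) fun M' hM' G hG => ?_⟩
    obtain ⟨k, l, hl, hmin, hGm⟩ := exists_affine_minorant hM'.2 hpos' hm hG
    simp only [Fin.sum_univ_two, ← add_assoc] at hmin hGm
    have hatt' := hM'.isAttainable hpos' (m := m) (c := k) (l := l) (fun i h => hl i (Or.inl h))
      (fun v h0 => hmin v (by
        rintro i (h | h)
        · exact (h0 i h).trans h.symm
        · exfalso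
          fin_cases i
          · exact hm0.ne h
          · exact hm1.ne h))
    have := hmax _ _ _ hatt' fun h => absurd h hm1.ne
    have h2 := le_add_of_max (c := k) (k0 := l 0) (k1 := l 1) (hm 0).1 (hm 1).1
    linarith

end Mechanism

/-! ### Suboptimality of corner-hitting auctions near the highest means -/

/-- The score of a bidder in a corner-hitting linear score auction. -/
theorem cornerHitting_score (r : Fin 2 → ℝ) (v : Profile vbar) (i : Fin 2) :
    score (fun i => if r i < vbar i then r i / (vbar i - r i) else r i)
      (fun i => if r i < vbar i then 1 / (vbar i - r i) else 1) v i =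
      if r i < vbar i then ((v i : ℝ) - r i) / (vbar i - r i) else (v i : ℝ) - r i := by
  simp only [score]
  split_ifs <;> ring

/-- A bound, uniform in the price `p`, on the value at `m0` of an affine function that is at most
`0` at `p` and at most `p` at `b`. -/
theorem posted_price_bound {b p m0 f0 f1 f : ℝ} (hpb : p < b) (hm : p ≤ m0) (hmb : m0 ≤ b)
    (h0 : f0 ≤ 0) (h1 : f1 ≤ p) (hf : (b - p) * f = (b - m0) * f0 + (m0 - p) * f1) {s : ℝ}
    (hs : s ^ 2 = b * (b - m0)) : f ≤ b + (b - m0) - 2 * s := by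
  have q0 := mul_nonneg (sub_nonneg.2 hmb) (neg_nonneg.2 h0)
  have q1 := mul_nonneg (sub_nonneg.2 hm) (sub_nonneg.2 h1)
  refine le_of_mul_le_mul_left ?_ (sub_pos.2 hpb)
  -- With `u = b - p`, interpolation gives `b + (b - m0) - (u + s ^ 2 / u)`, and `u + s ^ 2 / u ≥ 2
  -- * s`.
  nlinarith [sq_nonneg (b - p - s)]

/-- An attainable affine function whose value at `(b - e0, b1 - e1)` exceeds what posted prices for
the first bidder achieve. -/
theorem exists_isAttainable_gt {a b s e0 e1 : ℝ} (ha : 0 < a) (hab : a < b) (hs : 0 < s)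
    (hsD : s ≤ (b - a) / 4) (hse : s ^ 2 = b * e0) (he1 : e1 < a * (b - a) / (4 * b)) :
    ∃ c l0 l1, IsAttainable b a 0 c l0 l1 ∧
      b + e0 - 2 * s < c + l0 * (b - e0) + l1 * (a - e1) := by
  have hb : 0 < b := ha.trans hab
  have hD : 0 < b - a - s := by linarith
  -- On the edge `y = a` the function runs from `a` at `b - s` to `b - s` at `b`; a posted price `b
  -- - s` would start from `0`. Since `l0 * l1 = 1`, both alternatives of `cover` have the same
  -- boundary line.
  set l0 := (b - a - s) / s with hl0
  set l1 := s / (b - a - s) with hl1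
  have l0pos : 0 < l0 := div_pos hD hs
  have l1pos : 0 < l1 := div_pos hs hD
  have e0' : l0 * s = b - a - s := div_mul_cancel₀ _ hs.ne'
  have e1' : l1 * (b - a - s) = s := div_mul_cancel₀ _ hD.ne'
  have e01 : l0 * l1 = 1 := by rw [hl0, hl1]; field_simp
  refine ⟨b - s - l0 * b - l1 * a, l0, l1, ⟨l0pos.le, l1pos.le, fun x _ y _ _ => ?_⟩, ?_⟩
  · rcases le_or_gt (l1 * (y - a)) (x - (b - s)) with h | h
    · left; linarith
    · right
      have h2 := mul_lt_mul_of_pos_left h l0pos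
      have h3 : l0 * (l1 * (y - a)) = y - a := by rw [← mul_assoc, e01, one_mul]
      linarith
  · have h1 : l0 * (b * e0) = (b - a - s) * s := by
      rw [← hse, sq, ← mul_assoc, e0']
    rw [lt_div_iff₀ (by positivity)] at he1
    have h2 : b * e1 < a * (b - a - s) := by nlinarith
    have h3 : l1 * (b * e1) < a * s := by
      calc l1 * (b * e1) < l1 * (a * (b - a - s)) := mul_lt_mul_of_pos_left h2 l1pos
        _ = a * s := by linear_combination a * e1'
    -- The gain over the posted price bound is `a * s / b - l1 * e1`, positive by `h3`.
    refine lt_of_mul_lt_mul_left ?_ hb.le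
    linear_combination h3 + h1 - hse

/-- Needed because the allocation at the reserve price itself is a tie and hence unrestricted. -/
theorem affine_nonpos_of_forall_lt {p q r : ℝ} (hr : 0 < r) (h : ∀ x, 0 ≤ x → x < r → p + q * x ≤ 0) :
    p + q * r ≤ 0 := by
  have hc : Filter.Tendsto (fun x : ℝ => p + q * x) (nhdsWithin r (Set.Iio r)) (nhds (p + q * r)) :=
    (Continuous.tendsto (by fun_prop) r).mono_left nhdsWithin_le_nhds
  refine le_of_tendsto hc ?_
  filter_upwards [Ioo_mem_nhdsLT hr] with x hx using h x hx.1.le hx.2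

namespace Mechanism

/-- An affine function below the revenue of a corner-hitting linear score auction is bounded, at
means close to the highest values, by what posted prices for the first bidder achieve or by
roughly the highest value of the second bidder. -/
theorem IsCornerHittingLSA.minorant_le {M : Mechanism vbar} (hM : M.IsCornerHittingLSA)
    (hpos : 0 < vbar 1) (hlt : vbar 1 < vbar 0) {m : Fin 2 → ℝ} (hm0 : m 0 ∈ Set.Ioo 0 (vbar 0))
    (hm1 : m 1 ∈ Set.Ioo 0 (vbar 1)) {c l0 l1 s : ℝ}
    (hmin : ∀ v : Profile vbar, c + l0 * v 0 + l1 * v 1 ≤ M.revenue v)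
    (hs : s ^ 2 = vbar 0 * (vbar 0 - m 0)) :
    c + l0 * m 0 + l1 * m 1 ≤ 0 ∨
    c + l0 * m 0 + l1 * m 1 ≤ vbar 0 + (vbar 0 - m 0) - 2 * s ∨
    vbar 1 * (c + l0 * m 0 + l1 * m 1) ≤ vbar 1 * vbar 1 + (vbar 1 - m 1) * vbar 0 := by
  obtain ⟨r, hr, hfeas, -, -, halloc⟩ := hM
  have hpos0 : 0 < vbar 0 := hpos.trans hlt
  have hm0' : m 0 ∈ Set.Icc 0 (vbar 0) := Set.Ioo_subset_Icc_self hm0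
  have hm1' : m 1 ∈ Set.Icc 0 (vbar 1) := Set.Ioo_subset_Icc_self hm1
  have hb0 : vbar 0 ∈ Set.Icc 0 (vbar 0) := ⟨hpos0.le, le_rfl⟩
  have hb1 : vbar 1 ∈ Set.Icc 0 (vbar 1) := ⟨hpos.le, le_rfl⟩
  rcases (hr 1).2.lt_or_eq with hr1 | hr1
  -- Bidder `1` wins at `(m 0, vbar 1)` because her score is `1` there and that of bidder `0` is
  -- smaller. The bound interpolates between this profile and `(m 0, 0)`.
  · right; right
    have hwin : M.alloc 1 (profile hm0' hb1) = 1 := by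
      refine (halloc 1 _).1 ?_
      rw [scoreToBeat_one, cornerHitting_score, cornerHitting_score, if_pos hr1, profile_one,
        div_self (sub_pos.2 hr1).ne', profile_zero]
      refine max_lt ?_ one_pos
      split_ifs with h
      · rw [div_lt_one (sub_pos.2 h)]; linarith [hm0.2]
      · linarith [hm0.2]
    have h1 := (hmin (profile hm0' hb1)).trans
      ((hfeas.2.revenue_le_pay_one (alloc_zero_of_alloc_one hwin)).trans
        (hfeas.2.pay_le_value 1 _))
    have h00 : (0 : ℝ) ∈ Set.Icc 0 (vbar 1) := ⟨le_rfl, hpos.le⟩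
    have h2 := (hmin (profile hm0' h00)).trans (hfeas.2.revenue_le hlt.le _)
    simp only [profile_zero, profile_one, mul_zero, add_zero] at h1 h2
    have q1 := mul_le_mul_of_nonneg_left h1 hm1.1.le
    have q2 := mul_le_mul_of_nonneg_left h2 (sub_nonneg.2 hm1.2.le)
    have q3 := mul_le_mul_of_nonneg_right hm1.2.le hpos.le
    linarith
  have hlose1 : ∀ (x : ℝ) (hx : x ∈ Set.Icc 0 (vbar 0)), M.alloc 1 (profile hx hm1') = 0 := by
    intro x hx
    refine (halloc 1 _).2 ?_
    rw [scoreToBeat_one, cornerHitting_score _ _ 1, if_neg hr1.not_lt, profile_one, hr1]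
    exact lt_max_of_lt_right (by linarith [hm1.2])
  have hzero : ∀ x, 0 ≤ x → x < r 0 → c + l1 * m 1 + l0 * x ≤ 0 := by
    intro x hx hxr
    have hx' : x ∈ Set.Icc 0 (vbar 0) := ⟨hx, hxr.le.trans (hr 0).2⟩
    have hlose0 : M.alloc 0 (profile hx' hm1') = 0 := by
      refine (halloc 0 _).2 ?_
      rw [scoreToBeat_zero, cornerHitting_score _ _ 0, profile_zero]
      refine lt_max_of_lt_right ?_
      split_ifs with h
      · exact div_neg_of_neg_of_pos (by linarith) (sub_pos.2 h)
      · linarith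
    have := (hmin _).trans (hfeas.2.revenue_nonpos hlose0 (hlose1 x hx'))
    simp only [profile_zero, profile_one] at this
    linarith
  rcases lt_or_ge (m 0) (r 0) with hmr | hmr
  · left
    linarith [hzero (m 0) hm0.1.le hmr]
  right; left
  have hr0 : r 0 < vbar 0 := hmr.trans_lt hm0.2
  have hlow : c + l1 * m 1 + l0 * r 0 ≤ 0 := by
    -- A zero reserve leaves no values below it, but at value `0` bidder `0` pays at most `0`
    -- anyway.
    rcases (hr 0).1.eq_or_lt with h | h
    · have h00 : (0 : ℝ) ∈ Set.Icc 0 (vbar 0) := ⟨le_rfl, hpos0.le⟩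
      have := (hmin _).trans ((hfeas.2.revenue_le_pay_zero (hlose1 0 h00)).trans
        (hfeas.2.pay_le_value 0 _))
      simp only [profile_zero, profile_one] at this
      rw [← h]; linarith
    · exact affine_nonpos_of_forall_lt h hzero
  have hhigh : c + l0 * vbar 0 + l1 * m 1 ≤ r 0 := by
    refine le_of_forall_gt_imp_ge_of_dense fun x hx => ?_
    rcases le_or_gt x (vbar 0) with hxb | hxb
    · have hx' : x ∈ Set.Icc 0 (vbar 0) := ⟨(hr 0).1.trans hx.le, hxb⟩
      have hwin : M.alloc 0 (profile hx' hm1') = 1 := by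
        refine (halloc 0 _).1 ?_
        rw [scoreToBeat_zero, cornerHitting_score, cornerHitting_score, if_neg hr1.not_lt,
          if_pos hr0, profile_zero, profile_one, hr1]
        have hp : 0 < (x - r 0) / (vbar 0 - r 0) := div_pos (sub_pos.2 hx) (sub_pos.2 hr0)
        exact max_lt ((sub_neg.2 hm1.2).trans hp) hp
      exact (hmin (profile hb0 hm1')).trans (hfeas.revenue_zero_le hx' hm1' hwin hb0)
    · have := (hmin (profile hb0 hm1')).trans (hfeas.2.revenue_le hlt.le _)
      simp only [profile_zero, profile_one] at this
      linarith
  exact posted_price_bound hr0 hmr hm0.2.le hlow hhigh (by ring) hs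

/-- At means close to the highest values, no corner-hitting linear score auction is optimal. -/
theorem exists_not_isCornerHittingLSA (hpos : 0 < vbar 1) (hlt : vbar 1 < vbar 0) :
    ∃ ε : ℝ, 0 < ε ∧ ∀ m : Fin 2 → ℝ, (∀ i, m i ∈ Set.Ioo (vbar i - ε) (vbar i)) →
      ∀ M : Mechanism vbar, M.IsOptimal m → ¬ M.IsCornerHittingLSA := by
  have hpos0 : 0 < vbar 0 := hpos.trans hlt
  have hD : 0 < vbar 0 - vbar 1 := sub_pos.2 hlt
  have hpos' : ∀ i, 0 < vbar i := by
    intro i; fin_cases i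
    · exact hpos0
    · exact hpos
  -- The first term gives `s ≤ (vbar 0 - vbar 1) / 4`; the second is the bound on `e1` in
  -- `exists_isAttainable_gt`.
  set ε := min ((vbar 0 - vbar 1) ^ 2 / (16 * vbar 0))
    (vbar 1 * (vbar 0 - vbar 1) / (4 * vbar 0)) with hε
  have hε0 : ε ≤ (vbar 0 - vbar 1) ^ 2 / (16 * vbar 0) := min_le_left _ _
  have hε1 : ε ≤ vbar 1 * (vbar 0 - vbar 1) / (4 * vbar 0) := min_le_right _ _
  refine ⟨ε, lt_min (by positivity) (by positivity), fun m hm M hopt hcorner => ?_⟩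
  have he0 : vbar 0 - m 0 < (vbar 0 - vbar 1) ^ 2 / (16 * vbar 0) := by linarith [(hm 0).1]
  have he1 : vbar 1 - m 1 < vbar 1 * (vbar 0 - vbar 1) / (4 * vbar 0) := by linarith [(hm 1).1]
  have he0' := he0
  have he1' := he1
  rw [lt_div_iff₀ (by positivity)] at he0' he1'
  have hm0 : m 0 ∈ Set.Ioo 0 (vbar 0) := by
    refine ⟨?_, (hm 0).2⟩
    by_contra! hcon
    nlinarith
  have hm1 : m 1 ∈ Set.Ioo 0 (vbar 1) := by
    refine ⟨?_, (hm 1).2⟩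
    by_contra! hcon
    nlinarith
  have hm' : ∀ i, m i ∈ Set.Icc (0 : ℝ) (vbar i) := by
    intro i; fin_cases i
    · exact Set.Ioo_subset_Icc_self hm0
    · exact Set.Ioo_subset_Icc_self hm1
  have hprod : 0 < vbar 0 * (vbar 0 - m 0) := mul_pos hpos0 (sub_pos.2 hm0.2)
  set s := Real.sqrt (vbar 0 * (vbar 0 - m 0)) with hs
  have spos : 0 < s := Real.sqrt_pos.2 hprod
  have ssq : s ^ 2 = vbar 0 * (vbar 0 - m 0) := Real.sq_sqrt hprod.le
  have hsD : s ≤ (vbar 0 - vbar 1) / 4 := by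
    refine abs_le_of_sq_le_sq' ?_ (by positivity) |>.2
    rw [ssq]; nlinarith
  obtain ⟨c, l0, l1, hatt, hgt⟩ := exists_isAttainable_gt hpos hlt spos hsD ssq he1
  obtain ⟨r0, hr0, r1, hr1, γ, hγ, hrev⟩ := exists_linearScore_ge hpos hlt.le hatt
  have hG := (le_guarantee_linearScore (m := m) hγ hr0.1 hr1.1 fun v _ => hrev v).trans
    (hopt.2 _ (linearScore_isFeasible hγ))
  obtain ⟨k, l, -, hmin, hkm⟩ := exists_affine_minorant hopt.1.2 hpos' hm' hG
  simp only [Fin.sum_univ_two, ← add_assoc] at hmin hkm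
  rw [sub_sub_cancel, sub_sub_cancel, ← hkm] at hgt
  have hm0b := (hm 0).2
  rcases hcorner.minorant_le hpos hlt hm0 hm1 (fun v => hmin v (by
      rintro i (h | h)
      · exfalso
        fin_cases i
        · exact hm0.1.ne' h
        · exact hm1.1.ne' h
      · exact absurd h (hm i).2.ne)) ssq with h | h | h
  · linarith
  · linarith
  -- The secured value exceeds `vbar 0 - 2 * s`, hence the midpoint of `vbar 1` and `vbar 0`, while
  -- `h` and `he1'` keep it below `vbar 1 + (vbar 0 - vbar 1) / 4`.
  · have h2 : vbar 1 * (vbar 1 + (vbar 0 - vbar 1) / 4) <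
        vbar 1 * (k + l 0 * m 0 + l 1 * m 1) :=
      mul_lt_mul_of_pos_left (by linarith) hpos
    linarith

end Mechanism

end RobustAuction

end

theorem mainTheorem7 (vbar : Fin 2 → ℝ) (hpos : 0 < vbar 1) (hle : vbar 1 ≤ vbar 0) :
    (∀ m : Fin 2 → ℝ, (∀ i, m i ∈ Set.Icc (0 : ℝ) (vbar i)) →
      ∃ (M : RobustAuction.Mechanism vbar) (r : Fin 2 → ℝ) (γ : ℝ),
        (∀ i, r i ∈ Set.Icc (0 : ℝ) (vbar i)) ∧ 0 < γ ∧
        M.IsLSAWith ![γ * r 0, r 1] ![γ, 1] ∧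
        M.IsOptimal m) ∧
    (vbar 1 < vbar 0 →
      ∃ ε : ℝ, 0 < ε ∧ ∀ m : Fin 2 → ℝ, (∀ i, m i ∈ Set.Ioo (vbar i - ε) (vbar i)) →
        ∀ M : RobustAuction.Mechanism vbar, M.IsOptimal m → ¬ M.IsCornerHittingLSA) := by
  refine ⟨fun m hm => ?_, RobustAuction.Mechanism.exists_not_isCornerHittingLSA hpos⟩
  obtain ⟨r0, hr0, r1, hr1, γ, hγ, hopt⟩ :=
    RobustAuction.Mechanism.exists_linearScore_isOptimal hpos hle hm
  refine ⟨_, ![r0, r1], γ, fun i => ?_, hγ,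
    RobustAuction.Mechanism.linearScore_isLSAWith hγ hr0.1 hr1.1, hopt⟩
  fin_cases i
  · exact hr0
  · exact hr1
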